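/- Let $\mathfrak g$ be a finite-dimensional simple complex Lie algebra with $\mathrm{rank}(\mathfrak g)\ge 2$, let $\{x_i\}$ be a basis of $\mathfrak g$, and let $\alpha_{ij}^{\;k}\in\mathbb C$ be its structure constants, $[x_i,x_j]=\sum_k\alpha_{ij}^{\;k}x_k$. Let $\mathfrak g[u]=\mathfrak g\otimes\mathbb C[u]$ be the half-loop Lie algebra, with elements $x^{(k)}=x\otimes u^k$ and bracket $[x^{(k)},y^{(l)}]=[x,y]^{(k+l)}$, and let $\mathfrak g[u^2]\subset\mathfrak g[u]$ be the even half-loop Lie algebra, i.e. the Lie subalgebra spanned by the elements $x^{(2k)}$, $x\in\mathfrak g$, $k\ge 0$. Then $\mathfrak g[u^2]$ is isomorphic to the complex Lie algebra presented by generators $x_i$ and $G(x_i)$ (one pair for each basis vector), where $G$ is extended linearly to $\mathfrak g$, i.e. $G(\lambda y+\mu z)=\lambda G(y)+\mu G(z)$ for $\lambda,\mu\in\mathbb C$ and $y,z\in\mathfrak g$, and by the defining relations $$[x_i,x_j]=\sum_k\alpha_{ij}^{\;k}\,x_k,\qquad [x_i,G(x_j)]=\sum_k\alpha_{ij}^{\;k}\,G(x_k),$$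 $$[G(x_i),G([x_j,x_k])]+[G(x_j),G([x_k,x_i])]+[G(x_k),G([x_i,x_j])]=0$$ for all $i,j,k$. An isomorphism is given by $x_i\mapsto x_i^{(0)}$, $G(x_i)\mapsto x_i^{(2)}$. -/

import Mathlib

open scoped TensorProduct

noncomputable section

/-- The half-loop algebra `𝔤[u] = ℂ[u] ⊗ 𝔤`, with bracket
`[p ⊗ x, q ⊗ y] = p q ⊗ [x, y]`, as a Lie algebra over `ℂ`. -/
abbrev HalfLoop (𝔤 : Type*) [LieRing 𝔤] [LieAlgebra ℂ 𝔤] : Type _ :=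
  Polynomial ℂ ⊗[ℂ] 𝔤

/-- The standard element `x^{(k)} = x ⊗ u^k` of the half-loop algebra. -/
def HalfLoop.level {𝔤 : Type*} [LieRing 𝔤] [LieAlgebra ℂ 𝔤] (k : ℕ) (x : 𝔤) : HalfLoop 𝔤 :=
  (Polynomial.X ^ k : Polynomial ℂ) ⊗ₜ[ℂ] x

theorem HalfLoop.lie_level {𝔤 : Type*} [LieRing 𝔤] [LieAlgebra ℂ 𝔤] (k l : ℕ) (x y : 𝔤) :
    ⁅HalfLoop.level k x, HalfLoop.level l y⁆ = HalfLoop.level (k + l) ⁅x, y⁆ := by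
  simp [HalfLoop.level, LieAlgebra.ExtendScalars.bracket_tmul, pow_add]

/-- The even half-loop algebra `𝔤[u²]`: the Lie subalgebra of `𝔤[u]` spanned by the elements
`x^{(2k)}` with `x ∈ 𝔤` and `k ≥ 0`. -/
def evenHalfLoop (𝔤 : Type*) [LieRing 𝔤] [LieAlgebra ℂ 𝔤] : LieSubalgebra ℂ (HalfLoop 𝔤) where
  toSubmodule := Submodule.span ℂ {z | ∃ (k : ℕ) (x : 𝔤), z = HalfLoop.level (2 * k) x}
  lie_mem' := by
    intro z w hz hw
    induction hz, hw using Submodule.span_induction₂ with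
    | mem_mem a b ha hb =>
      obtain ⟨k, x, rfl⟩ := ha
      obtain ⟨l, y, rfl⟩ := hb
      refine Submodule.subset_span ⟨k + l, ⁅x, y⁆, ?_⟩
      rw [HalfLoop.lie_level, mul_add]
    | zero_left b hb => rw [zero_lie]; exact Submodule.zero_mem _
    | zero_right a ha => rw [lie_zero]; exact Submodule.zero_mem _
    | add_left a b c _ _ _ h₁ h₂ => rw [add_lie]; exact Submodule.add_mem _ h₁ h₂
    | add_right a b c _ _ _ h₁ h₂ => rw [lie_add]; exact Submodule.add_mem _ h₁ h₂
    | smul_left r a b _ _ h => rw [smul_lie]; exact Submodule.smul_mem _ r h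
    | smul_right r a b _ _ h => rw [lie_smul]; exact Submodule.smul_mem _ r h

/-- The element `x^{(2k)}` of the even half-loop algebra. -/
def evenHalfLoop.level {𝔤 : Type*} [LieRing 𝔤] [LieAlgebra ℂ 𝔤] (k : ℕ) (x : 𝔤) :
    evenHalfLoop 𝔤 :=
  ⟨HalfLoop.level (2 * k) x, Submodule.subset_span ⟨k, x, rfl⟩⟩

namespace DrinfeldEven

/-- The symbols `x_i` and `G(x_i)`, indexed by a basis of `𝔤`. -/
inductive Gen (ι : Type*) : Type _
  | x : ι → Gen ι
  | G : ι → Gen ι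

variable {𝔤 : Type*} [LieRing 𝔤] [LieAlgebra ℂ 𝔤] {ι : Type*} [Fintype ι]

/-- The structure constants `α_{ij}^k` of `𝔤` in the basis `b`:
`[b i, b j] = ∑ k, α_{ij}^k b k`. -/
def structConst (b : Module.Basis ι ℂ 𝔤) (i j k : ι) : ℂ :=
  b.repr ⁅b i, b j⁆ k

/-- The symbol `x_i` in the free Lie algebra. -/
def freeX (i : ι) : FreeLieAlgebra ℂ (Gen ι) := FreeLieAlgebra.of ℂ (Gen.x i)

/-- The linear map `y ↦ G(y)` from `𝔤` to the free Lie algebra, which sends the basis vector `b i`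
to the symbol `G(x_i)`; thus `G(λ y + μ z) = λ G(y) + μ G(z)`. -/
def freeG (b : Module.Basis ι ℂ 𝔤) : 𝔤 →ₗ[ℂ] FreeLieAlgebra ℂ (Gen ι) :=
  b.constr ℂ fun i => FreeLieAlgebra.of ℂ (Gen.G i)

/-- The defining relators, each to be set to zero. -/
inductive IsRelator (b : Module.Basis ι ℂ 𝔤) : FreeLieAlgebra ℂ (Gen ι) → Prop
  /-- `[x_i, x_j] = α_{ij}^k x_k` -/
  | xx (i j : ι) :
      IsRelator b (⁅freeX i, freeX j⁆ - ∑ k, structConst b i j k • freeX k)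
  /-- `[x_i, G(x_j)] = α_{ij}^k G(x_k)` -/
  | xG (i j : ι) :
      IsRelator b (⁅freeX i, freeG b (b j)⁆ - ∑ k, structConst b i j k • freeG b (b k))
  /-- `[G(x_i), G([x_j, x_k])] + [G(x_j), G([x_k, x_i])] + [G(x_k), G([x_i, x_j])] = 0` -/
  | terrific (i j k : ι) :
      IsRelator b (⁅freeG b (b i), freeG b ⁅b j, b k⁆⁆ + ⁅freeG b (b j), freeG b ⁅b k, b i⁆⁆
        + ⁅freeG b (b k), freeG b ⁅b i, b j⁆⁆)

/-- The Lie ideal of the free Lie algebra generated by the relators. -/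
def relationIdeal (b : Module.Basis ι ℂ 𝔤) : LieIdeal ℂ (FreeLieAlgebra ℂ (Gen ι)) :=
  LieSubmodule.lieSpan ℂ (FreeLieAlgebra ℂ (Gen ι)) {r | IsRelator b r}

/-- The complex Lie algebra presented by the generators `x_i`, `G(x_i)` and the relations above. -/
abbrev Presented (b : Module.Basis ι ℂ 𝔤) : Type _ :=
  FreeLieAlgebra ℂ (Gen ι) ⧸ relationIdeal b

/-- The generator `x_i` of the presented Lie algebra. -/
def x (b : Module.Basis ι ℂ 𝔤) (i : ι) : Presented b :=
  LieSubmodule.Quotient.mk (freeX i)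

/-- The linear map `y ↦ G(y)` from `𝔤` to the presented Lie algebra. -/
def G (b : Module.Basis ι ℂ 𝔤) : 𝔤 →ₗ[ℂ] Presented b :=
  (LieSubmodule.Quotient.mk' (relationIdeal b) : _ →ₗ[ℂ] Presented b) ∘ₗ freeG b

end DrinfeldEven

end

/-! ### Root spaces of a simple Lie algebra -/

namespace LieAlgebra

section Roots

open LieModule

/-! The morphism to `𝔤[u²]` exists because the relators vanish there. The substance is that the
presented algebra is no larger: it must be spanned by levels `G_k(𝔤)`, with `G_0 = X` and `G_1 = G`,
satisfying `⁅G_i x, G_j y⁆ = G_{i+j} ⁅x, y⁆`. Then `∑ y_k ↦ ∑ G_k(y_k)` is onto, and composed with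
the morphism it is the bijection `∑ y_k ↦ ∑ y_k^{(2k)}`, so the morphism is bijective.

The multiplication rule is proved by induction on the level (`lie_levelMap`). The Jacobi identity,
or the cubic relation when `n = 1`, gives `B x y = ⁅G x, G_n y⁆` a cocycle-like identity, which
forces `B x y = φ ⁅x, y⁆ + κ(x, y) w` with `κ` the Killing form (`exists_eq_lie_add_killingForm`).
Skew-symmetry of the bracket then kills `w`.

For scalar `B`, the Killing form turns `B` into an endomorphism `D` with `⁅D x, y⁆ + ⁅x, D y⁆ = E
⁅x, y⁆`. The difference `D - E` satisfies a Bianchi identity. In rank at least two, every root `β`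
has a companion root other than `±β`, and this rigidity makes Bianchi endomorphisms commute with
`ad`, hence scalar by Schur's lemma. So `D` is a derivation up to a scalar, hence inner up to a
scalar. -/

theorem eq_zero_of_forall_lie_eq_zero (K : Type*) {L : Type*} [Field K] [LieRing L]
    [LieAlgebra K L] [IsSimple K L] {w : L} (hw : ∀ v : L, ⁅v, w⁆ = 0) : w = 0 := by
  have h : w ∈ center K L := hw
  rwa [center_eq_bot, LieSubmodule.mem_bot] at h

theorem iSup_rootSpace_induction {K L : Type*} [Field K] [IsAlgClosed K] [LieRing L]
    [LieAlgebra K L] [FiniteDimensional K L] {H : LieSubalgebra K L} [H.IsCartanSubalgebra]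
    {p : L → Prop} (hzero : ∀ h ∈ H, p h)
    (hroot : ∀ α : Weight K H L, α.IsNonZero → ∀ v ∈ rootSpace H α, p v)
    (hadd : ∀ v w, p v → p w → p (v + w)) (v : L) : p v := by
  have hv : v ∈ (⨆ χ : Weight K H L, genWeightSpace L χ : LieSubmodule K H L) := by
    rw [iSup_genWeightSpace_eq_top' K H L]; trivial
  rw [← LieSubmodule.mem_toSubmodule, LieSubmodule.iSup_toSubmodule] at hv
  induction hv using Submodule.iSup_induction' with
  | mem χ x hx =>
    by_cases hχ : χ.IsZero
    · have hχ0 : (χ : H → K) = 0 := hχ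
      rw [hχ0] at hx
      have hx' : x ∈ rootSpace H (0 : H → K) := hx
      rw [rootSpace_zero_eq] at hx'
      exact hzero x hx'
    · exact hroot χ hχ x hx
  | zero => exact hzero 0 H.zero_mem
  | add x y _ _ hx hy => exact hadd x y hx hy

variable {K L : Type*} [Field K] [CharZero K] [IsAlgClosed K] [LieRing L] [LieAlgebra K L]
  [FiniteDimensional K L] [IsSimple K L] {H : LieSubalgebra K L} [H.IsCartanSubalgebra]

theorem lie_eq_smul_of_mem_rootSpace' {α : H → K} {v : L} (hv : v ∈ rootSpace H α) (h : H) :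
    ⁅(h : L), v⁆ = α h • v :=
  IsKilling.lie_eq_smul_of_mem_rootSpace hv h

theorem exists_weight_ne_ne_neg (hH : 2 ≤ Module.finrank K H) (β : Weight K H L) :
    ∃ γ : Weight K H L, γ.IsNonZero ∧ γ ≠ β ∧ γ ≠ -β := by
  by_contra! hcon
  have hle : (⊤ : Submodule K (Module.Dual K H)) ≤
      Submodule.span K {Weight.toLinear K H L β} := by
    rw [← IsKilling.span_weight_isNonZero_eq_top K L H, Submodule.span_le]
    rintro _ ⟨γ, hγ, rfl⟩
    by_cases h : γ = β
    · subst h; exact Submodule.mem_span_singleton_self _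
    · rw [hcon γ hγ h, Weight.toLinear_neg]
      exact Submodule.neg_mem _ (Submodule.mem_span_singleton_self _)
  have h1 := Submodule.finrank_mono hle
  rw [finrank_top, Subspace.dual_finrank_eq] at h1
  have h2 := finrank_span_le_card (R := K) ({Weight.toLinear K H L β} : Set (Module.Dual K H))
  simp at h2
  omega

/-- The centralizer of the root spaces other than `±β`, as an ideal. -/
def rootCentralizer (β : Weight K H L) (hβ : β.IsNonZero) : LieIdeal K L where
  carrier := {w | ∀ γ : Weight K H L, γ.IsNonZero → γ ≠ β → γ ≠ -β → ∀ e ∈ rootSpace H γ, ⁅e, w⁆ = 0}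
  add_mem' := by
    intro a b ha hb γ h1 h2 h3 e he
    rw [lie_add, ha γ h1 h2 h3 e he, hb γ h1 h2 h3 e he, add_zero]
  zero_mem' := by
    intro γ _ _ _ e _
    exact lie_zero e
  smul_mem' := by
    intro c a ha γ h1 h2 h3 e he
    rw [lie_smul, ha γ h1 h2 h3 e he, smul_zero]
  lie_mem := by
    intro x w hw
    change ∀ γ : Weight K H L, _ at hw
    change ∀ γ : Weight K H L, _
    -- Shifting `γ` by a multiple of `β` keeps it off the line of `β`, since `±β` are the only roots
    -- on that line. For `x` in any other root space, `⁅x, w⁆` is already zero.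
    have key : ∀ (δ : H → K), (δ = 0 ∨ δ = β ∨ δ = -β) → ∀ x ∈ rootSpace H δ,
        ∀ γ : Weight K H L, γ.IsNonZero → γ ≠ β → γ ≠ -β → ∀ e ∈ rootSpace H γ,
          ⁅e, ⁅x, w⁆⁆ = 0 := by
      intro δ hδ x hx γ h1 h2 h3 e he
      rw [leibniz_lie, hw γ h1 h2 h3 e he, lie_zero, add_zero]
      have hex : ⁅e, x⁆ ∈ rootSpace H (γ + δ) := lie_mem_genWeightSpace_of_mem_genWeightSpace he hx
      by_cases hbot : rootSpace H (γ + δ : H → K) = ⊥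
      · rw [hbot, LieSubmodule.mem_bot] at hex
        rw [hex, zero_lie]
      let ε : Weight K H L := ⟨γ + δ, hbot⟩
      have hmul : ∀ k : K, (γ : H → K) ≠ k • (β : H → K) := by
        intro k hk
        rcases IsKilling.eq_neg_or_eq_of_eq_smul β γ h1 k hk with h | h
        · exact h3 h
        · exact h2 h
      have hε : (ε : H → K) = γ + δ := rfl
      obtain ⟨k, hk⟩ : ∃ k : K, δ = k • (β : H → K) := by
        rcases hδ with h | h | h
        · exact ⟨0, by rw [h, zero_smul]⟩
        · exact ⟨1, by rw [h, one_smul]⟩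
        · exact ⟨-1, by rw [h, neg_smul, one_smul]⟩
      have hne : ∀ l : K, (ε : H → K) ≠ l • (β : H → K) := by
        intro l hl
        apply hmul (l - k)
        rw [sub_smul, ← hl, hε, hk, add_sub_cancel_right]
      refine hw ε ?_ ?_ ?_ _ hex
      · intro h0
        apply hne 0
        rw [zero_smul]
        exact h0
      · intro h0
        apply hne 1
        rw [one_smul, h0]
      · intro h0
        apply hne (-1)
        rw [neg_smul, one_smul, h0, Weight.coe_neg]
    refine iSup_rootSpace_induction (H := H) (p := fun x => ∀ γ : Weight K H L, γ.IsNonZero →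
      γ ≠ β → γ ≠ -β → ∀ e ∈ rootSpace H γ, ⁅e, ⁅x, w⁆⁆ = 0) ?_ ?_ ?_ x
    · intro h hh
      refine key 0 (Or.inl rfl) h ?_
      rw [rootSpace_zero_eq]
      exact hh
    · intro α hα v hv γ h1 h2 h3 e he
      by_cases ha : α = β
      · subst ha
        exact key α (Or.inr (Or.inl rfl)) v hv γ h1 h2 h3 e he
      by_cases hb : α = -β
      · subst hb
        exact key _ (Or.inr (Or.inr rfl)) v hv γ h1 h2 h3 e he
      rw [hw α hα ha hb v hv, lie_zero]
    · intro a b ha hb γ h1 h2 h3 e he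
      rw [add_lie, lie_add, ha γ h1 h2 h3 e he, hb γ h1 h2 h3 e he, add_zero]

/-- By simplicity it suffices that the ideal is proper; otherwise a nonzero root vector for a root
other than `±β` would be central. -/
theorem rootCentralizer_eq_bot (hH : 2 ≤ Module.finrank K H) (β : Weight K H L)
    (hβ : β.IsNonZero) : rootCentralizer β hβ = ⊥ := by
  refine (IsSimple.eq_bot_or_eq_top (R := K) (rootCentralizer β hβ)).resolve_right fun htop => ?_
  obtain ⟨γ, h1, h2, h3⟩ := exists_weight_ne_ne_neg hH β
  obtain ⟨e, he, hne⟩ := γ.exists_ne_zero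
  apply hne
  apply eq_zero_of_forall_lie_eq_zero K
  intro v
  have hv : v ∈ rootCentralizer β hβ := by rw [htop]; trivial
  rw [← lie_skew, hv γ h1 h2 h3 e he, neg_zero]

theorem eq_zero_of_forall_rootSpace_lie_eq_zero (hH : 2 ≤ Module.finrank K H) {β : Weight K H L}
    (hβ : β.IsNonZero) {w : L}
    (hw : ∀ γ : Weight K H L, γ.IsNonZero → γ ≠ β → γ ≠ -β → ∀ e ∈ rootSpace H γ, ⁅e, w⁆ = 0) :
    w = 0 := by
  have h : w ∈ rootCentralizer β hβ := hw
  rwa [rootCentralizer_eq_bot hH, LieSubmodule.mem_bot] at h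

/-- Non-proportional roots are linearly independent functionals, so one is nonzero on the kernel of
the other. -/
theorem exists_apply_eq_zero_apply_eq_one {β γ : Weight K H L} (hβ : β.IsNonZero)
    (h2 : γ ≠ β) (h3 : γ ≠ -β) : ∃ h : H, γ h = 0 ∧ β h = 1 := by
  have hex : ∃ h : H, γ h = 0 ∧ β h ≠ 0 := by
    by_contra! hcon
    have hmem : Weight.toLinear K H L β ∈
        Submodule.span K (Set.range fun _ : Unit => Weight.toLinear K H L γ) := by
      apply mem_span_of_iInf_ker_le_ker
      intro h hh
      rw [Submodule.mem_iInf] at hh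
      exact hcon h (hh ())
    rw [Set.range_const, Submodule.mem_span_singleton] at hmem
    obtain ⟨k, hk⟩ := hmem
    have hk' : (β : H → K) = k • (γ : H → K) := by
      ext h
      have := LinearMap.congr_fun hk h
      simpa using this.symm
    rcases IsKilling.eq_neg_or_eq_of_eq_smul γ β hβ k hk' with h | h
    · exact h3 (by rw [h, neg_neg])
    · exact h2 h.symm
  obtain ⟨h, hγ, hne⟩ := hex
  refine ⟨(β h)⁻¹ • h, ?_, ?_⟩
  · have := (Weight.toLinear K H L γ).map_smul (β h)⁻¹ h
    simp only [Weight.toLinear_apply] at this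
    rw [this, hγ, smul_zero]
  · have := (Weight.toLinear K H L β).map_smul (β h)⁻¹ h
    simp only [Weight.toLinear_apply] at this
    rw [this, smul_eq_mul, inv_mul_cancel₀ hne]

end Roots

end LieAlgebra
/-! ### Endomorphisms satisfying the Bianchi identity -/

namespace LieAlgebra

/-- The linear endomorphisms `F` of `L` such that `∑ ⁅F ⁅x, y⁆, z⁆ = 0`, the sum being cyclic. -/
def bianchi (K L : Type*) [CommRing K] [LieRing L] [LieAlgebra K L] :
    LieSubmodule K L (L →ₗ[K] L) where
  carrier := {F | ∀ x y z, ⁅F ⁅x, y⁆, z⁆ + ⁅F ⁅y, z⁆, x⁆ + ⁅F ⁅z, x⁆, y⁆ = 0}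
  add_mem' := by
    intro F G hF hG x y z
    have h1 := hF x y z
    have h2 := hG x y z
    simp only [LinearMap.add_apply, add_lie]
    rw [← add_zero (0 : L)]
    nth_rw 1 [← h1]
    rw [← h2]
    abel
  zero_mem' := by
    intro x y z
    simp
  smul_mem' := by
    intro c F hF x y z
    simp only [LinearMap.smul_apply, smul_lie, ← smul_add]
    rw [hF x y z, smul_zero]
  lie_mem := by
    intro a F hF
    change ∀ x y z, ⁅F ⁅x, y⁆, z⁆ + ⁅F ⁅y, z⁆, x⁆ + ⁅F ⁅z, x⁆, y⁆ = 0 at hF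
    intro x y z
    have h0 : ⁅a, ⁅F ⁅x, y⁆, z⁆ + ⁅F ⁅y, z⁆, x⁆ + ⁅F ⁅z, x⁆, y⁆⁆ = 0 := by
      rw [hF, lie_zero]
    have h1 := hF ⁅a, x⁆ y z
    have h2 := hF x ⁅a, y⁆ z
    have h3 := hF x y ⁅a, z⁆
    -- Equivariance: `a` acting on the whole identity, minus `a` acting on each argument in turn,
    -- leaves `a` acting on `F`.
    have h4 := congrArg₂ (· - ·) h0 (congrArg₂ (· + ·) h1 (congrArg₂ (· + ·) h2 h3))
    simp only [add_zero, sub_zero] at h4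
    simp only [LieHom.lie_apply, sub_lie]
    rw [← h4]
    simp only [lie_add, leibniz_lie a, map_add, add_lie]
    abel

/-! ### Rigidity of Bianchi endomorphisms in rank at least two. -/

section Bianchi

open LieModule

variable {K L : Type*} [Field K] [CharZero K] [IsAlgClosed K] [LieRing L] [LieAlgebra K L]
  [FiniteDimensional K L] [IsSimple K L] {H : LieSubalgebra K L} [H.IsCartanSubalgebra]

omit [IsAlgClosed K] in
theorem lie_cartan_eq_zero [IsTriangularizable K H L] (h k : H) : ⁅(h : L), (k : L)⁆ = 0 := by
  have := congrArg (fun x : H => (x : L)) (trivial_lie_zero H H h k)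
  simpa using this

omit [IsAlgClosed K] in
theorem lie_cartan_comm [IsTriangularizable K H L] (h k : H) (v : L) :
    ⁅(h : L), ⁅(k : L), v⁆⁆ = ⁅(k : L), ⁅(h : L), v⁆⁆ := by
  rw [leibniz_lie, lie_cartan_eq_zero, zero_lie, zero_add]

theorem bianchi_smul_lie {F : L →ₗ[K] L} (hF : F ∈ bianchi K L) {α : H → K} {v : L}
    (hv : v ∈ rootSpace H α) (h k : H) :
    α k • ⁅(h : L), F v⁆ = α h • ⁅(k : L), F v⁆ := by
  have h1 := hF h k v
  rw [lie_cartan_eq_zero, map_zero, zero_lie, zero_add, lie_eq_smul_of_mem_rootSpace' hv,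
    ← lie_skew v, lie_eq_smul_of_mem_rootSpace' hv, map_neg, map_smul, map_smul, neg_lie, smul_lie,
    smul_lie, ← lie_skew, ← lie_skew (F v) (k : L), smul_neg, smul_neg, neg_neg] at h1
  exact (neg_add_eq_zero.mp h1)

theorem bianchi_lie_eq_zero {F : L →ₗ[K] L} (hF : F ∈ bianchi K L) {α : H → K} {v : L}
    (hv : v ∈ rootSpace H α) {h k : H} (hh : α h = 0) (hk : α k ≠ 0) : ⁅(h : L), F v⁆ = 0 := by
  have h1 := bianchi_smul_lie hF hv h k
  rw [hh, zero_smul] at h1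
  exact (smul_eq_zero.mp h1).resolve_left hk

theorem bianchi_lie_root_eq {F : L →ₗ[K] L} (hF : F ∈ bianchi K L) {β γ : H → K} {v e : L}
    (hv : v ∈ rootSpace H β) (he : e ∈ rootSpace H γ) {h : H} (hγ : γ h = 0) :
    ⁅(h : L), F ⁅e, v⁆⁆ = β h • ⁅e, F v⁆ := by
  have h1 := hF h e v
  rw [lie_eq_smul_of_mem_rootSpace' he, hγ, zero_smul, map_zero, zero_lie, zero_add, ← lie_skew v,
    lie_eq_smul_of_mem_rootSpace' hv, map_neg, map_smul, neg_lie, smul_lie,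
    ← lie_skew, ← lie_skew (F v) e, smul_neg, neg_neg] at h1
  exact (neg_add_eq_zero.mp h1)

/-- This says that `F` preserves weights of root vectors. The identity on two Cartan elements and
`v` gives `⁅h, F v⁆ = β h • w` for a fixed `w`; a second root `γ` is needed to identify `w` with `F
v`. -/
theorem bianchi_lie_cartan_eq (hH : 2 ≤ Module.finrank K H) {F : L →ₗ[K] L}
    (hF : F ∈ bianchi K L) {β : Weight K H L} (hβ : β.IsNonZero) {v : L}
    (hv : v ∈ rootSpace H β) (h : H) : ⁅(h : L), F v⁆ = β h • F v := by
  obtain ⟨γ₀, hγ₀, h2₀, h3₀⟩ := exists_weight_ne_ne_neg hH β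
  obtain ⟨k₀, -, hk₀⟩ := exists_apply_eq_zero_apply_eq_one hβ h2₀ h3₀
  have hlin : ∀ k : H, ⁅(k : L), F v⁆ = β k • ⁅(k₀ : L), F v⁆ := by
    intro k
    have := bianchi_smul_lie hF hv k k₀
    rwa [hk₀, one_smul] at this
  have hw : F v - ⁅(k₀ : L), F v⁆ = 0 := by
    apply eq_zero_of_forall_rootSpace_lie_eq_zero hH hβ
    intro γ h1 h2 h3 e he
    -- With `a`, `b` dual to `β`, `γ`, the weight `γ + β` vanishes on `b - a`, so `b - a` kills `F
    -- ⁅e, v⁆` and hence `⁅e, F v⁆ = ⁅a, F ⁅e, v⁆⁆`. Expanding by Leibniz gives `⁅e, F v - w⁆ = 0`.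
    obtain ⟨a, haγ, haβ⟩ := exists_apply_eq_zero_apply_eq_one hβ h2 h3
    obtain ⟨b, hbβ, hbγ⟩ := exists_apply_eq_zero_apply_eq_one h1 h2.symm
      (fun h => h3 (by rw [h, neg_neg]))
    have e1 := bianchi_lie_root_eq hF hv he haγ
    rw [haβ, one_smul] at e1
    have hsub : ∀ χ : Weight K H L, χ (b - a) = χ b - χ a := by
      intro χ
      have := (Weight.toLinear K H L χ).map_sub b a
      simpa only [Weight.toLinear_apply] using this
    have hev : ⁅e, v⁆ ∈ rootSpace H (γ + β) := lie_mem_genWeightSpace_of_mem_genWeightSpace he hv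
    have e2 : ⁅((b - a : H) : L), F ⁅e, v⁆⁆ = 0 := by
      refine bianchi_lie_eq_zero (k := a) hF hev ?_ ?_
      · rw [Pi.add_apply, hsub, hsub, haγ, haβ, hbγ, hbβ]; ring
      · rw [Pi.add_apply, haγ, haβ]; simp
    have e3 : ⁅((b - a : H) : L), ⁅e, F v⁆⁆ = 0 := by
      rw [← e1, lie_cartan_comm, e2, lie_zero]
    rw [leibniz_lie, lie_eq_smul_of_mem_rootSpace' he, hlin (b - a), hsub, hsub, hbγ, haγ, hbβ, haβ,
      sub_zero, one_smul, zero_sub, neg_smul, one_smul, lie_neg] at e3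
    rw [lie_sub, sub_eq_add_neg, e3]
  rw [hlin, ← sub_eq_zero.mp hw]

/-- The Cartan subalgebra is spanned by brackets `⁅y, z⁆` of opposite root vectors. In the identity
for `y`, `z` and a root vector `e` of another root, two terms vanish, so `M ⁅y, z⁆` commutes with
every such `e`. -/
theorem bianchi_eq_zero_of_forall_rootSpace (hH : 2 ≤ Module.finrank K H) {M : L →ₗ[K] L}
    (hM : M ∈ bianchi K L)
    (h0 : ∀ β : Weight K H L, β.IsNonZero → ∀ v ∈ rootSpace H β, M v = 0) : M = 0 := by
  have h0' : ∀ χ : H → K, χ ≠ 0 → ∀ v ∈ rootSpace H χ, M v = 0 := by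
    intro χ hχ v hv
    by_cases hbot : rootSpace H χ = ⊥
    · rw [hbot, LieSubmodule.mem_bot] at hv
      rw [hv, map_zero]
    · exact h0 ⟨χ, hbot⟩ (fun h => hχ h) v hv
  have hcoroot : ∀ γ : Weight K H L, γ.IsNonZero → ∀ x ∈ corootSpace (γ : H → K),
      M (x : L) = 0 := by
    intro γ hγ x hx
    rw [mem_corootSpace] at hx
    suffices h : Submodule.span K {x | ∃ y ∈ rootSpace H γ, ∃ z ∈ rootSpace H (-γ), ⁅y, z⁆ = x} ≤
        LinearMap.ker M from h hx
    rw [Submodule.span_le]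
    rintro _ ⟨y, hy, z, hz, rfl⟩
    change M ⁅y, z⁆ = 0
    apply eq_zero_of_forall_rootSpace_lie_eq_zero hH hγ
    intro β h1 h2 h3 e he
    have h4 := hM y z e
    rw [h0' (-γ + β) _ _ (lie_mem_genWeightSpace_of_mem_genWeightSpace hz he),
      h0' (β + γ) _ _ (lie_mem_genWeightSpace_of_mem_genWeightSpace he hy), zero_lie, zero_lie,
      add_zero, add_zero] at h4
    · rw [← lie_skew, h4, neg_zero]
    · intro h
      exact h3 (DFunLike.coe_injective (by rw [Weight.coe_neg]; exact eq_neg_of_add_eq_zero_left h))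
    · intro h
      exact h2 (DFunLike.coe_injective (neg_add_eq_zero.mp h).symm)
  ext x
  refine iSup_rootSpace_induction (H := H) (p := fun x => M x = 0) ?_ h0 ?_ x
  · intro h hh
    have hmem : (⟨h, hh⟩ : H) ∈
        (⨆ α : Weight K H L, ⨆ (_ : α.IsNonZero), corootSpace (α : H → K) : LieIdeal K H) := by
      rw [IsKilling.biSup_corootSpace_eq_top]; trivial
    rw [← LieSubmodule.mem_toSubmodule, LieSubmodule.iSup_toSubmodule] at hmem
    simp only [LieSubmodule.iSup_toSubmodule] at hmem
    have hle : ⨆ α : Weight K H L, ⨆ (_ : α.IsNonZero), (corootSpace (α : H → K)).toSubmodule ≤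
        LinearMap.ker (M ∘ₗ H.toSubmodule.subtype) :=
      iSup₂_le fun α hα x hx => hcoroot α hα x hx
    exact hle hmem
  · intro a b ha hb
    rw [map_add, ha, hb, add_zero]

/-- The kernel of the action on Bianchi endomorphisms is an ideal. It contains the nonzero Cartan
subalgebra, because `F` preserves root weights, so it is everything. -/
theorem lie_bianchi_eq_zero (hH : 2 ≤ Module.finrank K H) {F : L →ₗ[K] L}
    (hF : F ∈ bianchi K L) (x : L) : ⁅x, F⁆ = 0 := by
  have hcartan : ∀ h : H, (h : L) ∈ LieModule.ker K L (bianchi K L) := by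
    intro h
    rw [LieModule.mem_ker]
    rintro ⟨F, hF⟩
    apply Subtype.ext
    change ⁅(h : L), F⁆ = 0
    apply bianchi_eq_zero_of_forall_rootSpace hH ((bianchi K L).lie_mem hF)
    intro β hβ v hv
    rw [LieHom.lie_apply, bianchi_lie_cartan_eq hH hF hβ hv, lie_eq_smul_of_mem_rootSpace' hv,
      map_smul, sub_self]
  have htop : LieModule.ker K L (bianchi K L) = ⊤ := by
    refine (IsSimple.eq_bot_or_eq_top (R := K) _).resolve_left fun hbot => ?_
    have : Nontrivial H := Module.nontrivial_of_finrank_pos (R := K) (by omega)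
    obtain ⟨h, hne⟩ := exists_ne (0 : H)
    have := hcartan h
    rw [hbot, LieSubmodule.mem_bot] at this
    exact hne (Subtype.ext this)
  have hx : x ∈ LieModule.ker K L (bianchi K L) := by rw [htop]; trivial
  rw [LieModule.mem_ker] at hx
  exact congrArg Subtype.val (hx ⟨F, hF⟩)

omit [CharZero K] in
theorem exists_eq_smul_of_forall_lie_eq_zero {F : L →ₗ[K] L} (hF : ∀ x : L, ⁅x, F⁆ = 0) :
    ∃ c : K, ∀ x, F x = c • x := by
  have : Nontrivial L := LieAlgebra.IsSimple.nontrivial K L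
  obtain ⟨c, hc⟩ := Module.End.exists_eigenvalue F
  have hcomm : ∀ x y : L, F ⁅x, y⁆ = ⁅x, F y⁆ := by
    intro x y
    have := LinearMap.congr_fun (hF x) y
    rw [LieHom.lie_apply, LinearMap.zero_apply] at this
    exact (sub_eq_zero.mp this).symm
  let I : LieIdeal K L :=
    { Module.End.eigenspace F c with
      lie_mem := by
        intro x m hm
        have hm' : m ∈ Module.End.eigenspace F c := hm
        rw [Module.End.mem_eigenspace_iff] at hm'
        change ⁅x, m⁆ ∈ Module.End.eigenspace F c
        rw [Module.End.mem_eigenspace_iff, hcomm, hm', lie_smul] }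
  have hI : I = ⊤ := by
    refine (IsSimple.eq_bot_or_eq_top (R := K) I).resolve_left fun hbot => ?_
    obtain ⟨v, hv⟩ := hc.exists_hasEigenvector
    have : v ∈ I := hv.1
    rw [hbot, LieSubmodule.mem_bot] at this
    exact hv.2 this
  refine ⟨c, fun x => ?_⟩
  have hx : x ∈ I := by rw [hI]; trivial
  exact Module.End.mem_eigenspace_iff.mp hx

omit H [H.IsCartanSubalgebra] in
variable (K) in
/-- Quasi-derivations of a simple Lie algebra of rank at least two are inner up to scalars. -/
theorem exists_eq_lie_add_smul_of_quasiderivation (hrank : 2 ≤ LieAlgebra.rank K L)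
    {D E : L →ₗ[K] L} (hDE : ∀ x y, ⁅D x, y⁆ + ⁅x, D y⁆ = E ⁅x, y⁆) :
    ∃ (a : L) (c : K), ∀ x, D x = ⁅a, x⁆ + c • x := by
  obtain ⟨r, hr⟩ := exists_isCartanSubalgebra_engel K L
  have hH := hrank.trans (rank_le_finrank_engel K r)
  -- Apply `E` to the Jacobi identity; the discrepancy is the sum of three Jacobi identities, with
  -- `D` on one argument in each.
  have hF : D - E ∈ bianchi K L := by
    intro x y z
    have hE : ∀ x y z : L, ⁅E ⁅x, y⁆, z⁆ = ⁅⁅D x, y⁆, z⁆ + ⁅⁅x, D y⁆, z⁆ := by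
      intro x y z
      rw [← hDE, add_lie]
    have hid : ∀ a b c : L, ⁅⁅a, b⁆, c⁆ + ⁅⁅b, c⁆, a⁆ + ⁅⁅c, a⁆, b⁆ = 0 := by
      intro a b c
      rw [← lie_skew ⁅a, b⁆, ← lie_skew ⁅b, c⁆, ← lie_skew ⁅c, a⁆, ← neg_add, ← neg_add, neg_eq_zero,
        ← lie_jacobi c a b]
    have hJ := congrArg E (hid x y z)
    simp only [map_add, map_zero, ← hDE] at hJ
    simp only [LinearMap.sub_apply, sub_lie, hE]
    linear_combination (norm := abel) hJ - hid (D x) y z - hid x (D y) z - hid x y (D z)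
  obtain ⟨c, hc⟩ := exists_eq_smul_of_forall_lie_eq_zero (lie_bianchi_eq_zero hH hF)
  -- Since `D - E = c`, adding `c` to `D` contributes `2c` on the Leibniz side, which is exactly
  -- what turns `E` into `D + c`.
  let D₀ : LieDerivation K L L :=
    { toLinearMap := D + c • LinearMap.id
      leibniz' := by
        intro x y
        have h1 := hDE x y
        have h2 : D ⁅x, y⁆ - E ⁅x, y⁆ = c • ⁅x, y⁆ := hc ⁅x, y⁆
        change D ⁅x, y⁆ + c • ⁅x, y⁆ = ⁅x, D y + c • y⁆ - ⁅y, D x + c • x⁆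
        rw [lie_add, lie_add, lie_smul, lie_smul, ← lie_skew y (D x), ← lie_skew y x]
        linear_combination (norm := module) h2 - h1 }
  obtain ⟨a, ha⟩ := LieDerivation.IsKilling.exists_eq_ad D₀
  refine ⟨a, -c, fun x => ?_⟩
  have h1 := LieDerivation.congr_fun ha x
  rw [LieDerivation.ad_apply_apply] at h1
  have h2 : D₀ x = D x + c • x := rfl
  rw [h1, h2, neg_smul, add_neg_cancel_right]

end Bianchi

end LieAlgebra
/-! ### Bilinear maps on a simple Lie algebra satisfying a cocycle condition -/

namespace LieAlgebra

variable {K L : Type*} [Field K] [CharZero K] [IsAlgClosed K] [LieRing L] [LieAlgebra K L]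
  [FiniteDimensional K L] [IsSimple K L]

/-- Nondegeneracy represents `B` and `C` by endomorphisms `D` and `E`, and invariance turns the
hypothesis into the quasi-derivation identity. The inner part of `D` yields `φ`, the scalar part the
Killing term. -/
theorem exists_eq_lie_add_killingForm_of_bilinForm (hrank : 2 ≤ LieAlgebra.rank K L)
    {B C : LinearMap.BilinForm K L}
    (hBC : ∀ x y z : L, B x ⁅y, z⁆ - B y ⁅x, z⁆ + C z ⁅x, y⁆ = 0) :
    ∃ (φ : Module.Dual K L) (c : K), ∀ x y, B x y = φ ⁅x, y⁆ + c * killingForm K L x y := by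
  have hnd := IsKilling.killingForm_nondegenerate K L
  let e := LinearMap.BilinForm.toDual (killingForm K L) hnd
  have he : ∀ (f : Module.Dual K L) (v : L), killingForm K L (e.symm f) v = f v :=
    fun f v => LinearMap.BilinForm.apply_toDual_symm_apply (hB := hnd) f v
  let D : L →ₗ[K] L := e.symm.toLinearMap ∘ₗ B
  let E : L →ₗ[K] L := -(e.symm.toLinearMap ∘ₗ LinearMap.flip C)
  have hD : ∀ x y, killingForm K L (D x) y = B x y := fun x y => he (B x) y
  have hE : ∀ x y, killingForm K L (E x) y = -C y x := by
    intro x y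
    change killingForm K L (-(e.symm (LinearMap.flip C x))) y = _
    rw [map_neg, LinearMap.neg_apply, he, LinearMap.flip_apply]
  have hkill : ∀ x y z : L, killingForm K L ⁅x, y⁆ z = killingForm K L x ⁅y, z⁆ :=
    LieModule.traceForm_apply_lie_apply K L L
  have hDE : ∀ x y, ⁅D x, y⁆ + ⁅x, D y⁆ = E ⁅x, y⁆ := by
    intro x y
    apply e.injective
    ext z
    change killingForm K L _ z = killingForm K L _ z
    rw [← lie_skew x (D y), ← sub_eq_add_neg, map_sub, LinearMap.sub_apply, hkill, hkill, hD, hD,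
      hE]
    exact eq_neg_of_add_eq_zero_left (hBC x y z)
  obtain ⟨a, c, hac⟩ := exists_eq_lie_add_smul_of_quasiderivation K hrank hDE
  refine ⟨killingForm K L a, c, fun x y => ?_⟩
  rw [← hD, hac, map_add, map_smul, LinearMap.add_apply, LinearMap.smul_apply, hkill, smul_eq_mul]

/-- A bilinear map on a simple Lie algebra of rank at least two whose cyclic defect is controlled
by a second bilinear map factors through the bracket, up to the Killing form. -/
theorem exists_eq_lie_add_killingForm (hrank : 2 ≤ LieAlgebra.rank K L)
    {W : Type*} [AddCommGroup W] [Module K W] {B C : L →ₗ[K] L →ₗ[K] W}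
    (hBC : ∀ x y z : L, B x ⁅y, z⁆ - B y ⁅x, z⁆ + C z ⁅x, y⁆ = 0) :
    ∃ (φ : L →ₗ[K] W) (w : W), ∀ x y, B x y = φ ⁅x, y⁆ + killingForm K L x y • w := by
  let P : L ⊗[K] L →ₗ[K] L × K := (TensorProduct.lift (LieModule.toEnd K L L : L →ₗ[K] _)).prod
    (TensorProduct.lift (killingForm K L))
  -- Functionals on `W` separate points, so the scalar case suffices to show that `B` factors
  -- through the pair (bracket, Killing form).
  have hker : LinearMap.ker P ≤ LinearMap.ker (TensorProduct.lift B) := by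
    intro t ht
    rw [LinearMap.mem_ker] at ht ⊢
    rw [← Module.forall_dual_apply_eq_zero_iff K]
    intro f
    obtain ⟨φ, c, hφ⟩ := exists_eq_lie_add_killingForm_of_bilinForm hrank
      (B := B.compr₂ f) (C := C.compr₂ f) (by
        intro x y z
        have := congrArg f (hBC x y z)
        simpa using this)
    have heq : f ∘ₗ TensorProduct.lift B =
        (φ.coprod (c • LinearMap.id)) ∘ₗ P := by
      apply TensorProduct.ext'
      intro x y
      have := hφ x y
      simpa [P] using this
    have := LinearMap.congr_fun heq t
    rw [LinearMap.comp_apply, LinearMap.comp_apply, ht, map_zero] at this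
    exact this
  obtain ⟨ψ, hψ⟩ := LinearMap.exists_extend
    ((LinearMap.ker P).liftQ (TensorProduct.lift B) hker ∘ₗ P.quotKerEquivRange.symm.toLinearMap)
  have hψP : ∀ t, ψ (P t) = TensorProduct.lift B t := by
    intro t
    have := LinearMap.congr_fun hψ ⟨P t, LinearMap.mem_range_self P t⟩
    simp only [LinearMap.comp_apply, Submodule.subtype_apply] at this
    rw [this]
    have h2 : P.quotKerEquivRange.symm ⟨P t, LinearMap.mem_range_self P t⟩ =
        (LinearMap.ker P).mkQ t := by
      exact LinearMap.quotKerEquivRange_symm_apply_image P t _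
    exact congrArg _ h2
  refine ⟨ψ ∘ₗ LinearMap.inl K L K, ψ (0, 1), fun x y => ?_⟩
  have h1 := hψP (x ⊗ₜ y)
  have h2 : P (x ⊗ₜ y) = (⁅x, y⁆, 0) + killingForm K L x y • ((0 : L), (1 : K)) := by
    simp [P]
  rw [h2, map_add, map_smul, TensorProduct.lift.tmul] at h1
  exact h1.symm

end LieAlgebra
/-! ### Current-type families in a Lie algebra -/

namespace LieAlgebra

section Perfect

variable (K L : Type*) [Field K] [LieRing L] [LieAlgebra K L]

/-- The bracket as a linear map on the tensor square. -/
def bracketMap : L ⊗[K] L →ₗ[K] L :=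
  TensorProduct.lift (LieModule.toEnd K L L : L →ₗ[K] Module.End K L)

variable {K L} in
@[simp]
theorem bracketMap_tmul (x y : L) : bracketMap K L (x ⊗ₜ y) = ⁅x, y⁆ := by
  simp [bracketMap]

theorem bracketMap_surjective [IsSimple K L] : Function.Surjective (bracketMap K L) := by
  have htop : ⁅(⊤ : LieIdeal K L), (⊤ : LieIdeal K L)⁆ = ⊤ := by
    refine (IsSimple.eq_bot_or_eq_top (R := K) _).resolve_left fun hbot => ?_
    apply IsSimple.non_abelian K (L := L)
    refine ⟨fun x y => ?_⟩
    have h := LieSubmodule.lie_mem_lie (LieSubmodule.mem_top (R := K) (L := L) x)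
      (LieSubmodule.mem_top (R := K) (L := L) y)
    rwa [hbot, LieSubmodule.mem_bot] at h
  intro x
  have hx : x ∈ (⁅(⊤ : LieIdeal K L), (⊤ : LieIdeal K L)⁆).toSubmodule := by rw [htop]; trivial
  rw [LieSubmodule.lieIdeal_oper_eq_linear_span'] at hx
  suffices h : Submodule.span K {m : L | ∃ x ∈ (⊤ : LieIdeal K L), ∃ n ∈ (⊤ : LieIdeal K L),
      ⁅x, n⁆ = m} ≤ LinearMap.range (bracketMap K L) from h hx
  rw [Submodule.span_le]
  rintro _ ⟨a, -, b, -, rfl⟩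
  exact ⟨a ⊗ₜ b, bracketMap_tmul a b⟩

variable {L} in
theorem lie_induction [IsSimple K L] {p : L → Prop} (hzero : p 0) (hlie : ∀ a b : L, p ⁅a, b⁆)
    (hadd : ∀ a b, p a → p b → p (a + b)) (x : L) : p x := by
  obtain ⟨t, rfl⟩ := bracketMap_surjective K L x
  induction t with
  | zero => rwa [map_zero]
  | tmul a b => rw [bracketMap_tmul]; exact hlie a b
  | add s t hs ht => rw [map_add]; exact hadd _ _ hs ht

/-- A linear section of the bracket. -/
noncomputable def bracketSection [IsSimple K L] : L →ₗ[K] L ⊗[K] L :=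
  ((bracketMap K L).exists_rightInverse_of_surjective
    (LinearMap.range_eq_top.mpr (bracketMap_surjective K L))).choose

variable {L} in
theorem bracketMap_bracketSection [IsSimple K L] (x : L) :
    bracketMap K L (bracketSection K L x) = x :=
  LinearMap.congr_fun ((bracketMap K L).exists_rightInverse_of_surjective
    (LinearMap.range_eq_top.mpr (bracketMap_surjective K L))).choose_spec x

end Perfect

/-! ### Levels generated by `X` and `G`, and their multiplication rule. -/

section Level

variable {K L P : Type*} [Field K] [LieRing L] [LieAlgebra K L] [LieRing P] [LieAlgebra K P]

/-- The bilinear map `(x, y) ↦ ⁅f x, g y⁆`. -/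
def lieBilin (f g : L →ₗ[K] P) : L →ₗ[K] L →ₗ[K] P :=
  (LieModule.toEnd K P P : P →ₗ[K] Module.End K P).compl₁₂ f g

@[simp]
theorem lieBilin_apply (f g : L →ₗ[K] P) (x y : L) : lieBilin f g x y = ⁅f x, g y⁆ := rfl

variable [IsSimple K L]

/-- The level maps generated by `X` in level zero and `G` in level one: each further level is
obtained by bracketing with `G`. -/
noncomputable def levelMap (X G : L →ₗ[K] P) : ℕ → L →ₗ[K] P
  | 0 => X
  | 1 => G
  | n + 2 => TensorProduct.lift (lieBilin G (levelMap X G (n + 1))) ∘ₗ bracketSection K L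

/-- Once `⁅G x, G_n y⁆` depends only on `⁅x, y⁆`, the arbitrary section of the bracket drops out of
the recursion. -/
theorem levelMap_succ {X G : L →ₗ[K] P} {n : ℕ} (hn : 1 ≤ n) {φ : L →ₗ[K] P}
    (hφ : ∀ x y, ⁅G x, levelMap X G n y⁆ = φ ⁅x, y⁆) : levelMap X G (n + 1) = φ := by
  obtain ⟨m, rfl⟩ : ∃ m, n = m + 1 := ⟨n - 1, by omega⟩
  have h : TensorProduct.lift (lieBilin G (levelMap X G (m + 1))) = φ ∘ₗ bracketMap K L := by
    apply TensorProduct.ext'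
    intro x y
    simp [hφ]
  rw [levelMap, h]
  ext x
  simp [bracketMap_bracketSection]

variable [CharZero K] [IsAlgClosed K] [FiniteDimensional K L] {X G : L →ₗ[K] P}

theorem lie_levelMap_succ (hrank : 2 ≤ LieAlgebra.rank K L)
    (hGG : ∀ x y z, ⁅G x, G ⁅y, z⁆⁆ + ⁅G y, G ⁅z, x⁆⁆ + ⁅G z, G ⁅x, y⁆⁆ = 0)
    {n : ℕ} (hn : 1 ≤ n)
    (hrel : ∀ i j, i + j ≤ n → ∀ x y,
      ⁅levelMap X G i x, levelMap X G j y⁆ = levelMap X G (i + j) ⁅x, y⁆)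
    {i j : ℕ} (hi : 1 ≤ i) (hj : 1 ≤ j) (hij : i + j = n + 1) (x y : L) :
    ⁅levelMap X G i x, levelMap X G j y⁆ = levelMap X G (n + 1) ⁅x, y⁆ := by
  have hkill : ∀ x y z : L, killingForm K L ⁅x, y⁆ z = killingForm K L x ⁅y, z⁆ :=
    LieModule.traceForm_apply_lie_apply K L L
  -- For `n = 1` this is the cubic relation. For larger `n` it is the Jacobi identity for `G x`, `G
  -- y`, `G_{n-1} z`.
  have hcycle : ∃ C : L →ₗ[K] L →ₗ[K] P, ∀ x y z : L,
      lieBilin G (levelMap X G n) x ⁅y, z⁆ - lieBilin G (levelMap X G n) y ⁅x, z⁆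
        + C z ⁅x, y⁆ = 0 := by
    obtain rfl | hn2 : n = 1 ∨ 2 ≤ n := by omega
    · refine ⟨lieBilin G G, fun x y z => ?_⟩
      simp only [lieBilin_apply]
      rw [← hGG x y z, ← lie_skew z x, map_neg, lie_neg, ← sub_eq_add_neg]
      rfl
    · refine ⟨lieBilin (levelMap X G (n - 1)) (levelMap X G 2), fun x y z => ?_⟩
      have h1 : ∀ a b, levelMap X G n ⁅a, b⁆ = ⁅G a, levelMap X G (n - 1) b⁆ := by
        intro a b
        have h := hrel 1 (n - 1) (by omega) a b
        rw [show 1 + (n - 1) = n by omega] at h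
        exact h.symm
      have h2 : levelMap X G 2 ⁅x, y⁆ = ⁅G x, G y⁆ := (hrel 1 1 (by omega) x y).symm
      simp only [lieBilin_apply]
      rw [h1, h1, h2, ← lie_lie, ← lie_skew, neg_add_cancel]
  obtain ⟨C, hC⟩ := hcycle
  obtain ⟨φ, w, hφ⟩ := exists_eq_lie_add_killingForm hrank hC
  simp only [lieBilin_apply] at hφ
  -- Moving one `G` across the bracket adds one more copy of the Killing term, by invariance; hence
  -- the factor `i`.
  have hall : ∀ i j, 1 ≤ i → 1 ≤ j → i + j = n + 1 → ∀ x y,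
      ⁅levelMap X G i x, levelMap X G j y⁆ = φ ⁅x, y⁆ + ((i : K) * killingForm K L x y) • w := by
    intro i
    induction i with
    | zero => intro j h; omega
    | succ i ih =>
      intro j _ hj hij x y
      obtain rfl | hi : i = 0 ∨ 1 ≤ i := by omega
      · obtain rfl : j = n := by omega
        rw [zero_add, Nat.cast_one, one_mul]
        exact hφ x y
      · refine lie_induction K (p := fun x => ⁅levelMap X G (i + 1) x, levelMap X G j y⁆ =
          φ ⁅x, y⁆ + (((i + 1 : ℕ) : K) * killingForm K L x y) • w) ?_ ?_ ?_ x
        · simp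
        · intro a b
          have h1 : levelMap X G (i + 1) ⁅a, b⁆ = ⁅G a, levelMap X G i b⁆ := by
            rw [add_comm i 1]
            exact (hrel 1 i (by omega) a b).symm
          have h2 : ⁅levelMap X G i b, levelMap X G j y⁆ = levelMap X G n ⁅b, y⁆ := by
            rw [hrel i j (by omega), show i + j = n by omega]
          have h3 : ⁅G a, levelMap X G j y⁆ = levelMap X G (j + 1) ⁅a, y⁆ := by
            rw [add_comm j 1]
            exact hrel 1 j (by omega) a y
          rw [h1, lie_lie, h2, h3, hφ, ih (j + 1) hi (by omega) (by omega), lie_lie a b y,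
            map_sub, hkill a b y, ← hkill b a y, ← lie_skew b a, map_neg, LinearMap.neg_apply,
            hkill a b y, Nat.cast_add, Nat.cast_one]
          module
        · intro a b ha hb
          simp only [map_add, add_lie, LinearMap.add_apply, ha, hb]
          module
  -- Skew-symmetry compares `⁅G_n x, G y⁆`, with coefficient `n`, to `-⁅G y, G_n x⁆`, with
  -- coefficient `-1`, so `(n + 1) κ(x, y) w = 0`.
  have hw : w = 0 := by
    by_contra hw
    have hzero : ∀ x y, killingForm K L x y = 0 := by
      intro x y
      have h1 := hall n 1 hn le_rfl rfl x y
      have h2 := hφ y x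
      have h3 : ⁅levelMap X G n x, levelMap X G 1 y⁆ = -⁅G y, levelMap X G n x⁆ := (lie_skew _ _).symm
      have hsymm : killingForm K L y x = killingForm K L x y := LieModule.traceForm_comm K L L y x
      rw [h3, h2, hsymm, ← lie_skew x y, map_neg] at h1
      have h4 : (((n : K) + 1) * killingForm K L x y) • w = 0 := by
        linear_combination (norm := module) -h1
      have h5 := (smul_eq_zero.mp h4).resolve_right hw
      exact (mul_eq_zero.mp h5).resolve_left (by exact_mod_cast Nat.succ_ne_zero n)
    have : Nontrivial L := LieAlgebra.IsSimple.nontrivial K L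
    obtain ⟨v, hv⟩ := exists_ne (0 : L)
    exact hv ((IsKilling.killingForm_nondegenerate K L).1 v (hzero v))
  subst hw
  simp only [smul_zero, add_zero] at hφ hall
  rw [levelMap_succ hn hφ]
  exact hall i j hi hj hij x y

theorem lie_levelMap (hrank : 2 ≤ LieAlgebra.rank K L)
    (hXX : ∀ x y, ⁅X x, X y⁆ = X ⁅x, y⁆) (hXG : ∀ x y, ⁅X x, G y⁆ = G ⁅x, y⁆)
    (hGG : ∀ x y z, ⁅G x, G ⁅y, z⁆⁆ + ⁅G y, G ⁅z, x⁆⁆ + ⁅G z, G ⁅x, y⁆⁆ = 0)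
    (i j : ℕ) (x y : L) :
    ⁅levelMap X G i x, levelMap X G j y⁆ = levelMap X G (i + j) ⁅x, y⁆ := by
  suffices h : ∀ n i j, i + j ≤ n → ∀ x y,
      ⁅levelMap X G i x, levelMap X G j y⁆ = levelMap X G (i + j) ⁅x, y⁆ from
    h (i + j) i j le_rfl x y
  have hswap : ∀ i j, (∀ x y, ⁅levelMap X G i x, levelMap X G j y⁆ = levelMap X G (i + j) ⁅x, y⁆) →
      ∀ x y, ⁅levelMap X G j x, levelMap X G i y⁆ = levelMap X G (j + i) ⁅x, y⁆ := by
    intro i j h x y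
    rw [← lie_skew, h, ← lie_skew x y, map_neg, add_comm i j]
  intro n
  induction n with
  | zero =>
    intro i j hij x y
    obtain ⟨rfl, rfl⟩ : i = 0 ∧ j = 0 := by omega
    exact hXX x y
  | succ n ih =>
    obtain rfl | hn : n = 0 ∨ 1 ≤ n := by omega
    · intro i j hij
      obtain h | ⟨rfl, rfl⟩ | ⟨rfl, rfl⟩ : i + j ≤ 0 ∨ (i = 0 ∧ j = 1) ∨ (i = 1 ∧ j = 0) := by omega
      · exact ih i j h
      · exact hXG
      · exact hswap 0 1 hXG
    -- Level zero acts by derivations: write the level `n + 1` element as `⁅G a, G_n b⁆` and apply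
    -- Leibniz.
    · have hzero : ∀ x y,
          ⁅levelMap X G 0 x, levelMap X G (n + 1) y⁆ = levelMap X G (0 + (n + 1)) ⁅x, y⁆ := by
        intro x y
        rw [zero_add]
        refine lie_induction K (p := fun y => ⁅levelMap X G 0 x, levelMap X G (n + 1) y⁆ =
          levelMap X G (n + 1) ⁅x, y⁆) ?_ ?_ ?_ y
        · simp
        · intro a b
          have h1 := fun a b => lie_levelMap_succ hrank hGG hn ih le_rfl hn (add_comm 1 n) a b
          rw [← h1, leibniz_lie, ih 0 1 (by omega), ih 0 n (by omega), zero_add, zero_add, h1, h1,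
            ← map_add, ← leibniz_lie]
        · intro a b ha hb
          simp only [map_add, lie_add, ha, hb]
      intro i j hij
      obtain h | ⟨rfl, rfl⟩ | ⟨rfl, rfl⟩ | ⟨hi, hj, h⟩ : i + j ≤ n ∨ (i = 0 ∧ j = n + 1) ∨
        (i = n + 1 ∧ j = 0) ∨ (1 ≤ i ∧ 1 ≤ j ∧ i + j = n + 1) := by omega
      · exact ih i j h
      · exact hzero
      · exact hswap 0 (n + 1) hzero
      · rw [h]
        exact lie_levelMap_succ hrank hGG hn ih hi hj h

end Level

end LieAlgebra
/-! ### The presented Lie algebra and the even half-loop algebra -/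

namespace LieIdeal

variable {R L L' : Type*} [CommRing R] [LieRing L] [LieAlgebra R L] [LieRing L'] [LieAlgebra R L']

/-- The quotient map by an ideal, as a morphism of Lie algebras. -/
def quotientMk (I : LieIdeal R L) : L →ₗ⁅R⁆ L ⧸ I where
  toLinearMap := (LieSubmodule.Quotient.mk' I : L →ₗ[R] L ⧸ I)
  map_lie' {y z} := LieSubmodule.Quotient.mk_bracket (I := I) y z

/-- The morphism out of a quotient induced by a morphism that kills the ideal. -/
def quotientLift (I : LieIdeal R L) (f : L →ₗ⁅R⁆ L') (hf : ∀ z ∈ I, f z = 0) : L ⧸ I →ₗ⁅R⁆ L' where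
  toLinearMap := I.toSubmodule.liftQ (f : L →ₗ[R] L') hf
  map_lie' := by
    intro a b
    obtain ⟨a, rfl⟩ := LieSubmodule.Quotient.surjective_mk' I a
    obtain ⟨b, rfl⟩ := LieSubmodule.Quotient.surjective_mk' I b
    exact LieHom.map_lie f a b

end LieIdeal

/-! ### The even half-loop algebra as a direct sum of copies of `𝔤`. -/

section EvenHalfLoop

variable {𝔤 : Type*} [LieRing 𝔤] [LieAlgebra ℂ 𝔤]

namespace evenHalfLoop

/-- The map `x ↦ x^{(2k)}` as a linear map. -/
noncomputable def levelHom (k : ℕ) : 𝔤 →ₗ[ℂ] evenHalfLoop 𝔤 where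
  toFun := level k
  map_add' _ _ := Subtype.ext (TensorProduct.tmul_add _ _ _)
  map_smul' _ _ := Subtype.ext (TensorProduct.tmul_smul _ _ _)

theorem levelHom_apply (k : ℕ) (x : 𝔤) : levelHom k x = level k x := rfl

theorem lie_levelHom (k l : ℕ) (x y : 𝔤) :
    ⁅levelHom k x, levelHom l y⁆ = levelHom (k + l) ⁅x, y⁆ := by
  apply Subtype.ext
  change ⁅HalfLoop.level (2 * k) x, HalfLoop.level (2 * l) y⁆ = HalfLoop.level (2 * (k + l)) ⁅x, y⁆
  rw [HalfLoop.lie_level, mul_add]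

/-- The map `∑ x_k ↦ ∑ x_k^{(2k)}`. -/
noncomputable def sumLevel (𝔤 : Type*) [LieRing 𝔤] [LieAlgebra ℂ 𝔤] :
    (ℕ →₀ 𝔤) →ₗ[ℂ] evenHalfLoop 𝔤 :=
  Finsupp.lsum ℂ levelHom

theorem sumLevel_single (k : ℕ) (x : 𝔤) : sumLevel 𝔤 (Finsupp.single k x) = level k x := by
  rw [sumLevel, Finsupp.lsum_single, levelHom_apply]

theorem sumLevel_surjective : Function.Surjective (sumLevel 𝔤) := by
  rintro ⟨z, hz⟩
  have hle : Submodule.span ℂ {z | ∃ (k : ℕ) (x : 𝔤), z = HalfLoop.level (2 * k) x} ≤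
      LinearMap.range ((evenHalfLoop 𝔤).toSubmodule.subtype ∘ₗ sumLevel 𝔤) := by
    rw [Submodule.span_le]
    rintro _ ⟨k, x, rfl⟩
    refine ⟨Finsupp.single k x, ?_⟩
    rw [LinearMap.comp_apply, sumLevel_single]
    rfl
  obtain ⟨s, hs⟩ := hle hz
  exact ⟨s, Subtype.ext hs⟩

theorem sumLevel_injective : Function.Injective (sumLevel 𝔤) := by
  -- `c m` reads off the coefficient of `u^{2m}`, recovering the `m`-th summand.
  let c : ℕ → HalfLoop 𝔤 →ₗ[ℂ] 𝔤 := fun m =>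
    TensorProduct.lift ((LinearMap.lsmul ℂ 𝔤 : ℂ →ₗ[ℂ] _) ∘ₗ Polynomial.lcoeff ℂ (2 * m))
  have hc : ∀ m s, c m (sumLevel 𝔤 s : HalfLoop 𝔤) = s m := by
    intro m s
    have heq : c m ∘ₗ (evenHalfLoop 𝔤).toSubmodule.subtype ∘ₗ sumLevel 𝔤 = Finsupp.lapply m := by
      apply Finsupp.lhom_ext
      intro k x
      rw [LinearMap.comp_apply, LinearMap.comp_apply, sumLevel_single]
      change (Polynomial.X ^ (2 * k) : Polynomial ℂ).coeff (2 * m) • x = Finsupp.single k x m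
      rw [Polynomial.coeff_X_pow, Finsupp.single_apply]
      by_cases h : k = m
      · simp [h]
      · rw [if_neg h, if_neg (by omega), zero_smul]
    exact LinearMap.congr_fun heq s
  intro s t hst
  ext m
  rw [← hc, hst, hc]

end evenHalfLoop

end EvenHalfLoop

theorem Module.Basis.induction_linear {R M ι : Type*} [Semiring R] [AddCommMonoid M] [Module R M]
    (b : Module.Basis ι R M) {p : M → Prop} (hb : ∀ i, p (b i)) (hzero : p 0)
    (hadd : ∀ u v, p u → p v → p (u + v)) (hsmul : ∀ (c : R) u, p u → p (c • u)) (v : M) : p v := by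
  induction b.mem_span v using Submodule.span_induction with
  | mem u hu => obtain ⟨i, rfl⟩ := hu; exact hb i
  | zero => exact hzero
  | add u v _ _ hu hv => exact hadd u v hu hv
  | smul c u _ hu => exact hsmul c u hu

/-! ### Basis-free relations and the morphism to `𝔤[u²]`. -/

namespace DrinfeldEven

variable {𝔤 : Type*} [LieRing 𝔤] [LieAlgebra ℂ 𝔤] {ι : Type*} [Fintype ι]
  (b : Module.Basis ι ℂ 𝔤)

/-- The linear map from `𝔤` to the presented Lie algebra with `b i ↦ x_i`. -/
noncomputable def xHom : 𝔤 →ₗ[ℂ] Presented b := b.constr ℂ (x b)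

theorem xHom_basis (i : ι) : xHom b (b i) = x b i := b.constr_basis ℂ _ i

omit [Fintype ι] in
theorem freeG_basis (i : ι) : freeG b (b i) = FreeLieAlgebra.of ℂ (Gen.G i) :=
  b.constr_basis ℂ _ i

theorem G_apply (y : 𝔤) : G b y = (relationIdeal b).quotientMk (freeG b y) := rfl

theorem x_eq (i : ι) : x b i = (relationIdeal b).quotientMk (freeX i) := rfl

theorem quotientMk_eq_zero {r : FreeLieAlgebra ℂ (Gen ι)} (hr : IsRelator b r) :
    (relationIdeal b).quotientMk r = 0 :=
  (LieSubmodule.Quotient.mk_eq_zero (N := relationIdeal b)).mpr (LieSubmodule.subset_lieSpan hr)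

theorem sum_structConst_smul (i j : ι) : ∑ k, structConst b i j k • b k = ⁅b i, b j⁆ :=
  b.sum_repr _

theorem lie_xHom_xHom (y z : 𝔤) : ⁅xHom b y, xHom b z⁆ = xHom b ⁅y, z⁆ := by
  have h : LieAlgebra.lieBilin (xHom b) (xHom b) =
      (LieModule.toEnd ℂ 𝔤 𝔤 : 𝔤 →ₗ[ℂ] Module.End ℂ 𝔤).compr₂ (xHom b) := by
    refine b.ext fun i => b.ext fun j => ?_
    have h := quotientMk_eq_zero b (IsRelator.xx i j)
    rw [map_sub, sub_eq_zero, LieHom.map_lie, map_sum] at h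
    change ⁅xHom b (b i), xHom b (b j)⁆ = xHom b ⁅b i, b j⁆
    rw [← sum_structConst_smul, map_sum]
    simpa only [map_smul, xHom_basis, x_eq, G_apply] using h
  exact LinearMap.congr_fun₂ h y z

theorem lie_xHom_G (y z : 𝔤) : ⁅xHom b y, G b z⁆ = G b ⁅y, z⁆ := by
  have h : LieAlgebra.lieBilin (xHom b) (G b) =
      (LieModule.toEnd ℂ 𝔤 𝔤 : 𝔤 →ₗ[ℂ] Module.End ℂ 𝔤).compr₂ (G b) := by
    refine b.ext fun i => b.ext fun j => ?_
    have h := quotientMk_eq_zero b (IsRelator.xG i j)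
    rw [map_sub, sub_eq_zero, LieHom.map_lie, map_sum] at h
    change ⁅xHom b (b i), G b (b j)⁆ = G b ⁅b i, b j⁆
    rw [← sum_structConst_smul, map_sum]
    simpa only [map_smul, xHom_basis, x_eq, G_apply] using h
  exact LinearMap.congr_fun₂ h y z

theorem lie_G_G_cyclic (u v w : 𝔤) :
    ⁅G b u, G b ⁅v, w⁆⁆ + ⁅G b v, G b ⁅w, u⁆⁆ + ⁅G b w, G b ⁅u, v⁆⁆ = 0 := by
  induction u using b.induction_linear with
  | hzero => simp
  | hadd u u' h h' =>
    simp only [map_add, add_lie, lie_add]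
    linear_combination (norm := module) h + h'
  | hsmul c u h =>
    simp only [map_smul, smul_lie, lie_smul, ← smul_add, h, smul_zero]
  | hb i =>
  induction v using b.induction_linear with
  | hzero => simp
  | hadd u u' h h' =>
    simp only [map_add, add_lie, lie_add]
    linear_combination (norm := module) h + h'
  | hsmul c u h =>
    simp only [map_smul, smul_lie, lie_smul, ← smul_add, h, smul_zero]
  | hb j =>
  induction w using b.induction_linear with
  | hzero => simp
  | hadd u u' h h' =>
    simp only [map_add, add_lie, lie_add]
    linear_combination (norm := module) h + h'
  | hsmul c u h =>
    simp only [map_smul, smul_lie, lie_smul, ← smul_add, h, smul_zero]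
  | hb k =>
    have h := quotientMk_eq_zero b (IsRelator.terrific i j k)
    simpa only [map_add, LieHom.map_lie, G_apply] using h

/-- The morphism from the free Lie algebra to `𝔤[u²]` with `x_i ↦ x_i^{(0)}`,
`G(x_i) ↦ x_i^{(2)}`. -/
noncomputable def freeToEven : FreeLieAlgebra ℂ (Gen ι) →ₗ⁅ℂ⁆ evenHalfLoop 𝔤 :=
  FreeLieAlgebra.lift ℂ fun
    | Gen.x i => evenHalfLoop.levelHom 0 (b i)
    | Gen.G i => evenHalfLoop.levelHom 1 (b i)

omit [Fintype ι] in
theorem freeToEven_freeX (i : ι) : freeToEven b (freeX i) = evenHalfLoop.levelHom 0 (b i) := by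
  simp [freeToEven, freeX]

omit [Fintype ι] in
theorem freeToEven_freeG (y : 𝔤) : freeToEven b (freeG b y) = evenHalfLoop.levelHom 1 y := by
  have h : (freeToEven b : FreeLieAlgebra ℂ (Gen ι) →ₗ[ℂ] evenHalfLoop 𝔤) ∘ₗ freeG b =
      evenHalfLoop.levelHom 1 := by
    refine b.ext fun i => ?_
    change freeToEven b (freeG b (b i)) = _
    rw [freeG_basis]
    simp [freeToEven]
  exact LinearMap.congr_fun h y

theorem freeToEven_relator {r : FreeLieAlgebra ℂ (Gen ι)} (hr : IsRelator b r) :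
    freeToEven b r = 0 := by
  cases hr with
  | xx i j =>
    rw [map_sub, sub_eq_zero, LieHom.map_lie, map_sum]
    simp only [map_smul, freeToEven_freeX]
    rw [evenHalfLoop.lie_levelHom, ← sum_structConst_smul, map_sum]
    simp only [map_smul, add_zero]
  | xG i j =>
    rw [map_sub, sub_eq_zero, LieHom.map_lie, map_sum]
    simp only [map_smul, freeToEven_freeX, freeToEven_freeG]
    rw [evenHalfLoop.lie_levelHom, ← sum_structConst_smul, map_sum]
    simp only [map_smul, zero_add]
  | terrific i j k =>
    simp only [map_add, LieHom.map_lie, freeToEven_freeG, evenHalfLoop.lie_levelHom]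
    rw [← map_add, ← map_add, lie_jacobi, map_zero]

/-- The morphism from the presented Lie algebra to `𝔤[u²]`. -/
noncomputable def toEven : Presented b →ₗ⁅ℂ⁆ evenHalfLoop 𝔤 :=
  (relationIdeal b).quotientLift (freeToEven b) fun z hz => by
    have hle : relationIdeal b ≤ (freeToEven b).ker := by
      rw [relationIdeal, LieSubmodule.lieSpan_le]
      intro r hr
      exact (LieHom.mem_ker).mpr (freeToEven_relator b hr)
    exact (LieHom.mem_ker).mp (hle hz)

theorem toEven_x (i : ι) : toEven b (x b i) = evenHalfLoop.level 0 (b i) :=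
  freeToEven_freeX b i

theorem toEven_xHom (y : 𝔤) : toEven b (xHom b y) = evenHalfLoop.level 0 y := by
  have h : (toEven b : Presented b →ₗ[ℂ] evenHalfLoop 𝔤) ∘ₗ xHom b =
      evenHalfLoop.levelHom 0 := by
    refine b.ext fun i => ?_
    change toEven b (xHom b (b i)) = _
    rw [xHom_basis, toEven_x]
    rfl
  exact LinearMap.congr_fun h y

theorem toEven_G (y : 𝔤) : toEven b (G b y) = evenHalfLoop.level 1 y :=
  freeToEven_freeG b y

/-- A Lie subalgebra containing the generators is everything. -/
theorem mem_of_generators_mem {S : LieSubalgebra ℂ (Presented b)} (hx : ∀ i, x b i ∈ S)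
    (hG : ∀ i, G b (b i) ∈ S) (z : Presented b) : z ∈ S := by
  let f : FreeLieAlgebra ℂ (Gen ι) →ₗ⁅ℂ⁆ S := FreeLieAlgebra.lift ℂ fun
    | Gen.x i => ⟨x b i, hx i⟩
    | Gen.G i => ⟨G b (b i), hG i⟩
  have hf : S.incl.comp f = (relationIdeal b).quotientMk := by
    apply FreeLieAlgebra.hom_ext
    rintro (i | i)
    · simp [f, x_eq, freeX]
    · simp [f, G_apply, freeG_basis]
  obtain ⟨z, rfl⟩ := LieSubmodule.Quotient.surjective_mk' (relationIdeal b) z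
  have h := LieHom.congr_fun hf z
  change (f z : Presented b) = LieSubmodule.Quotient.mk' (relationIdeal b) z at h
  rw [← h]
  exact (f z).2

/-! ### Bijectivity by comparing levels. -/

section Simple

variable [FiniteDimensional ℂ 𝔤] [LieAlgebra.IsSimple ℂ 𝔤]

open LieAlgebra

theorem lie_level_level (hrank : 2 ≤ LieAlgebra.rank ℂ 𝔤) (i j : ℕ) (y z : 𝔤) :
    ⁅levelMap (xHom b) (G b) i y, levelMap (xHom b) (G b) j z⁆ =
      levelMap (xHom b) (G b) (i + j) ⁅y, z⁆ :=
  lie_levelMap hrank (lie_xHom_xHom b) (lie_xHom_G b) (lie_G_G_cyclic b) i j y z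

theorem toEven_levelMap (hrank : 2 ≤ LieAlgebra.rank ℂ 𝔤) (k : ℕ) (y : 𝔤) :
    toEven b (levelMap (xHom b) (G b) k y) = evenHalfLoop.level k y := by
  induction k generalizing y with
  | zero => exact toEven_xHom b y
  | succ k ih =>
    simp only [← evenHalfLoop.levelHom_apply] at ih ⊢
    refine lie_induction ℂ (p := fun y => toEven b (levelMap (xHom b) (G b) (k + 1) y) =
      evenHalfLoop.levelHom (k + 1) y) ?_ ?_ ?_ y
    · simp only [map_zero]
    · intro u v
      rw [add_comm k 1, ← lie_level_level b hrank, LieHom.map_lie, ih,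
        ← evenHalfLoop.lie_levelHom]
      exact congrArg (fun t => ⁅t, evenHalfLoop.levelHom k v⁆) (toEven_G b u)
    · intro u v hu hv
      simp only [map_add, hu, hv]

/-- The map `∑ y_k ↦ ∑ G_k(y_k)` onto the presented Lie algebra. -/
noncomputable def sumLevelMap : (ℕ →₀ 𝔤) →ₗ[ℂ] Presented b :=
  Finsupp.lsum ℂ (levelMap (xHom b) (G b))

omit [FiniteDimensional ℂ 𝔤] in
theorem sumLevelMap_single (k : ℕ) (y : 𝔤) :
    sumLevelMap b (Finsupp.single k y) = levelMap (xHom b) (G b) k y := by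
  simp [sumLevelMap]

theorem toEven_sumLevelMap (hrank : 2 ≤ LieAlgebra.rank ℂ 𝔤) (s : ℕ →₀ 𝔤) :
    toEven b (sumLevelMap b s) = evenHalfLoop.sumLevel 𝔤 s := by
  have h : (toEven b : Presented b →ₗ[ℂ] evenHalfLoop 𝔤) ∘ₗ sumLevelMap b =
      evenHalfLoop.sumLevel 𝔤 := by
    apply Finsupp.lhom_ext
    intro k y
    rw [evenHalfLoop.sumLevel_single, LinearMap.comp_apply, sumLevelMap_single]
    exact toEven_levelMap b hrank k y
  exact LinearMap.congr_fun h s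

/-- The multiplication rule makes the span of the levels a Lie subalgebra, and it contains the
generators in levels zero and one. -/
theorem sumLevelMap_surjective (hrank : 2 ≤ LieAlgebra.rank ℂ 𝔤) :
    Function.Surjective (sumLevelMap b) := by
  have hlie : ∀ s t, ⁅sumLevelMap b s, sumLevelMap b t⁆ ∈ LinearMap.range (sumLevelMap b) := by
    intro s t
    induction s using Finsupp.induction_linear with
    | zero => rw [map_zero, zero_lie]; exact Submodule.zero_mem _
    | add s s' h h' => rw [map_add, add_lie]; exact Submodule.add_mem _ h h'
    | single i y =>
      induction t using Finsupp.induction_linear with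
      | zero => rw [map_zero, lie_zero]; exact Submodule.zero_mem _
      | add t t' h h' => rw [map_add, lie_add]; exact Submodule.add_mem _ h h'
      | single j z =>
        exact ⟨Finsupp.single (i + j) ⁅y, z⁆, by
          rw [sumLevelMap_single, sumLevelMap_single, sumLevelMap_single,
            lie_level_level b hrank]⟩
  let S : LieSubalgebra ℂ (Presented b) :=
    { LinearMap.range (sumLevelMap b) with
      lie_mem' := by
        rintro _ _ ⟨s, rfl⟩ ⟨t, rfl⟩
        exact hlie s t }
  intro z
  refine mem_of_generators_mem b (S := S) (fun i => ?_) (fun i => ?_) z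
  · exact ⟨Finsupp.single 0 (b i), by rw [sumLevelMap_single, ← xHom_basis]; rfl⟩
  · exact ⟨Finsupp.single 1 (b i), by rw [sumLevelMap_single]; rfl⟩

theorem toEven_bijective (hrank : 2 ≤ LieAlgebra.rank ℂ 𝔤) : Function.Bijective (toEven b) := by
  have hcomp : toEven b ∘ sumLevelMap b = evenHalfLoop.sumLevel 𝔤 :=
    funext (toEven_sumLevelMap b hrank)
  constructor
  · have h : Function.Injective (toEven b ∘ sumLevelMap b) :=
      hcomp ▸ evenHalfLoop.sumLevel_injective
    exact h.of_comp_right (sumLevelMap_surjective b hrank)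
  · have h : Function.Surjective (toEven b ∘ sumLevelMap b) :=
      hcomp ▸ evenHalfLoop.sumLevel_surjective
    exact h.of_comp

end Simple

end DrinfeldEven

theorem proposition3p5 {𝔤 : Type*} [LieRing 𝔤] [LieAlgebra ℂ 𝔤] [FiniteDimensional ℂ 𝔤]
    [LieAlgebra.IsSimple ℂ 𝔤] (hrank : 2 ≤ LieAlgebra.rank ℂ 𝔤)
    {ι : Type*} [Fintype ι] (b : Module.Basis ι ℂ 𝔤) :
    ∃ e : DrinfeldEven.Presented b ≃ₗ⁅ℂ⁆ evenHalfLoop 𝔤,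
      (∀ i, e (DrinfeldEven.x b i) = evenHalfLoop.level 0 (b i)) ∧
      (∀ i, e (DrinfeldEven.G b (b i)) = evenHalfLoop.level 1 (b i)) :=
  ⟨LieEquiv.ofBijective (DrinfeldEven.toEven b) (DrinfeldEven.toEven_bijective b hrank),
    DrinfeldEven.toEven_x b, fun i => DrinfeldEven.toEven_G b (b i)⟩
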